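/- Write $\mathbb N=\{0,1,2,\dots\}$, let $\|\cdot\|$ be the Euclidean norm and $\mathbb B(x,\delta)$ the open ball of radius $\delta$ centred at $x$. Let $(\alpha_k)_{k\in\mathbb N}$ be a sequence of positive real numbers that converges to $0$ and is of order $\Omega(1/k)$, i.e. there are $c>0$ and $k_0\ge 1$ with $\alpha_k\ge c/k$ for all $k\ge k_0$. For each $k\in\mathbb N$ let $g(k,\cdot):\mathbb R^d\to\mathbb R^d$ be a $C^1$ map, and suppose that $x^*\in\mathbb R^d$ satisfies $g(k,x^*)=x^*$ for all $k$. For $x_0\in\mathbb R^d$ the orbit of $x_0$ is the sequence $x_{k+1}=g(k,x_k)$, $k\ge 0$. Let $$\theta(k,x)=g(k,x)-g(k,x^*)-D_xg(k,x^*)(x-x^*)$$ be the first-order Taylor remainder of $g(k,\cdot)$ at $x^*$, and assume: 1. there is a real $d\times d$ matrix $G$, diagonalizable over $\mathbb R$ and having at least one negative eigenvalue, such that $D_xg(k,x^*)=I-\alpha_kG$ for all $k\in\mathbb N$; 2. for every $\epsilon>0$ there is $\delta>0$ such that $\|\theta(k,u_1)-\theta(k,u_2)\|\le\alpha_k\,\epsilon\,\|u_1-u_2\|$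 for all $k\in\mathbb N$ and all $u_1,u_2\in\mathbb B(x^*,\delta)$. Then there exist an open neighborhood $U$ of $x^*$ and an embedded $C^1$ submanifold $W\subset U$ of $\mathbb R^d$, of codimension at least one, such that every $x_0$ whose orbit satisfies $x_k\in U$ for all $k\ge 0$ belongs to $W$. If, moreover, $0$ is not an eigenvalue of $G$, then $U$ and $W$ can be chosen so that, in addition, $\lim_{k\to\infty}x_k=x^*$ for the orbit of every $x_0\in W$. -/

import Mathlib

open Filter Topology Asymptotics

/-- The orbit `x_0 = x`, `x_{k+1} = g k x_k` of the time non-homogeneous dynamical system `g`. -/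
def orbit {d : ℕ} (g : ℕ → EuclideanSpace ℝ (Fin d) → EuclideanSpace ℝ (Fin d))
    (x : EuclideanSpace ℝ (Fin d)) : ℕ → EuclideanSpace ℝ (Fin d)
  | 0 => x
  | k + 1 => g k (orbit g x k)

/-- A real square matrix `G` is real diagonalizable: `G = Q⁻¹ diag(l₁, …, l_d) Q`
for an invertible real matrix `Q` and real numbers `l₁, …, l_d`. -/
def IsRealDiagonalizable {d : ℕ} (G : Matrix (Fin d) (Fin d) ℝ) : Prop :=
  ∃ (Q : Matrix (Fin d) (Fin d) ℝ) (l : Fin d → ℝ),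
    IsUnit Q.det ∧ G = Q⁻¹ * Matrix.diagonal l * Q

/-- The remainder `θ` of the first-order Taylor expansion of `f` at `p`,
`f x = f p + (D f p) (x - p) + θ x`. -/
noncomputable def taylorRemainder {d : ℕ}
    (f : EuclideanSpace ℝ (Fin d) → EuclideanSpace ℝ (Fin d))
    (p x : EuclideanSpace ℝ (Fin d)) : EuclideanSpace ℝ (Fin d) :=
  f x - (f p + fderiv ℝ f p (x - p))

/-- `W` is an (embedded) `C^1` submanifold of `ℝ^d` of dimension `m` (so of codimension `d - m`):
around each of its points there is a `C^1` diffeomorphism `Φ` between open subsets of `ℝ^d`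
that carries `W` to the coordinate plane in which all but the first `m` coordinates vanish. -/
def IsC1Submanifold {d : ℕ} (m : ℕ) (W : Set (EuclideanSpace ℝ (Fin d))) : Prop :=
  m ≤ d ∧ ∀ x ∈ W,
    ∃ Φ : OpenPartialHomeomorph (EuclideanSpace ℝ (Fin d)) (EuclideanSpace ℝ (Fin d)),
      x ∈ Φ.source ∧ ContDiffOn ℝ 1 Φ Φ.source ∧ ContDiffOn ℝ 1 Φ.symm Φ.target ∧
        ∀ y ∈ Φ.source, (y ∈ W ↔ ∀ i : Fin d, m ≤ (i : ℕ) → Φ y i = 0)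

/-! In eigencoordinates of `G` the system is, near the fixed point, a product map plus a small
Lipschitz error. The part with eigenvalues `≥ 0` hardly expands, and the part with negative
eigenvalues expands by at least `1 + 4β k`, where `β k` is a constant multiple of the step size.
After a cutoff this holds globally (`exists_saddle_normal_form`), though only from a time `K` on,
once the steps are small.

Differences of orbits then split into two regimes. A difference dominated by its unstable component
stays so and grows at least like `growth β k ^ 2`, whereas "slow" orbits grow at most like `growth β
k`. As `α` is of order at least `1/k`, `β` is not summable and `growth β` tends to infinity, so the
regimes exclude each other. Hence slow points form a `1`-Lipschitz graph over the stable factor;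
existence comes from pulling graphs back through finitely many steps and using compactness. The same
dichotomy for derivatives confines limiting difference quotients of the graph to a linear subspace
transverse to the unstable factor, which makes the graph `C¹` (`exists_contDiff_slow_graph`).

An orbit that stays in `U` is bounded, hence slow, so it lies on the graph at time `K`. `W` is the
preimage in `U` of the graph under the first `K` maps. These need not be invertible, but their
derivative at the fixed point is injective in the unstable directions, so the preimage is a
submanifold. If `0` is not an eigenvalue, the stable factor contracts and orbits on the graph
converge. -/

/-! ### Strict differentiability from limiting difference quotients -/

section StrictDerivative

variable {S V : Type*} [NormedAddCommGroup S] [NormedSpace ℝ S]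
  [NormedAddCommGroup V] [NormedSpace ℝ V]

/-- Strictness at `x` controls difference quotients at all pairs near `x`. Fixing one point `y` of
the pair makes `f - f' x` Lipschitz at `y` with small constant, which bounds `f' y - f' x`. -/
theorem contDiff_one_of_hasStrictFDerivAt {f : S → V}
    (hf : ∀ x, ∃ L : S →L[ℝ] V, HasStrictFDerivAt f L x) : ContDiff ℝ 1 f := by
  have hf' : ∀ x, HasStrictFDerivAt f (fderiv ℝ f x) x := fun x => by
    obtain ⟨L, hL⟩ := hf x
    rwa [hL.hasFDerivAt.fderiv]
  rw [contDiff_one_iff_fderiv]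
  refine ⟨fun x => (hf' x).hasFDerivAt.differentiableAt, continuous_iff_continuousAt.2 fun x => ?_⟩
  rw [ContinuousAt, Metric.tendsto_nhds]
  intro ε hε
  have h1 := (hf' x).isLittleO.def (half_pos hε)
  have h3 : ∀ᶠ y in 𝓝 x, ∀ᶠ z in 𝓝 y,
      ‖f y - f z - fderiv ℝ f x (y - z)‖ ≤ ε / 2 * ‖y - z‖ := by
    have h4 := (eventually_eventually_nhds.2 h1)
    have hc : Tendsto (fun y : S => (y, y)) (𝓝 x) (𝓝 (x, x)) :=
      (continuous_id.prodMk continuous_id).tendsto' _ _ rfl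
    filter_upwards [hc.eventually h4] with y hy
    have hc' : Tendsto (fun z : S => (y, z)) (𝓝 y) (𝓝 (y, y)) :=
      (continuous_const.prodMk continuous_id).tendsto' _ _ rfl
    exact hc'.eventually hy
  filter_upwards [h3] with y hy
  have hd : HasFDerivAt (fun z => f z - fderiv ℝ f x z) (fderiv ℝ f y - fderiv ℝ f x) y :=
    (hf' y).hasFDerivAt.sub (fderiv ℝ f x).hasFDerivAt
  have := norm_fderiv_le_of_lip' (f := fun z => f z - fderiv ℝ f x z) (x₀ := y) ℝ
    (half_pos hε).le (by
      filter_upwards [hy] with z hz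
      rw [norm_sub_rev, norm_sub_rev z y]
      rwa [show f y - fderiv ℝ f x y - (f z - fderiv ℝ f x z) =
        f y - f z - fderiv ℝ f x (y - z) by rw [map_sub]; abel])
  rw [hd.fderiv] at this
  rw [dist_eq_norm]
  linarith

/-- Compactness: the scaled differences of `h` are eventually bounded, and along an ultrafilter
boundedness already gives convergence. -/
theorem exists_tendsto_smul_sub_of_lipschitz [FiniteDimensional ℝ V] {ι : Type*} {h : S → V}
    (hh : LipschitzWith 1 h) (𝒰 : Ultrafilter ι) {a b : ι → S} {t : ι → ℝ} {u : S}
    (hu : Tendsto (fun i => t i • (a i - b i)) 𝒰 (𝓝 u)) :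
    ∃ w, Tendsto (fun i => t i • (h (a i) - h (b i))) 𝒰 (𝓝 w) := by
  have : ProperSpace V := FiniteDimensional.proper ℝ V
  have hb : ∀ᶠ i in (𝒰 : Filter ι), ‖t i • (a i - b i)‖ < ‖u‖ + 1 :=
    hu.norm.eventually_lt_const (lt_add_one _)
  have hmem : Metric.closedBall (0 : V) (‖u‖ + 1) ∈
      𝒰.map (fun i => t i • (h (a i) - h (b i))) := by
    change ∀ᶠ i in (𝒰 : Filter ι), _
    filter_upwards [hb] with i hi
    have := hh.norm_sub_le (a i) (b i)
    simp only [NNReal.coe_one, one_mul] at this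
    rw [mem_closedBall_zero_iff, norm_smul]
    rw [norm_smul] at hi
    exact (mul_le_mul_of_nonneg_left this (norm_nonneg _)).trans hi.le
  obtain ⟨w, -, hw⟩ := (isCompact_closedBall (0 : V) (‖u‖ + 1)).ultrafilter_le_nhds' _ hmem
  exact ⟨w, hw⟩

/-- A Lipschitz map all of whose limiting difference quotients at `x` lie in a linear subspace
that meets `{0} × V` trivially is strictly differentiable at `x`. -/
theorem exists_hasStrictFDerivAt_of_tangent [FiniteDimensional ℝ S] [FiniteDimensional ℝ V]
    {h : S → V} (hh : LipschitzWith 1 h) (x : S) (T : Submodule ℝ (S × V))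
    (hT0 : ∀ w, ((0 : S), w) ∈ T → w = 0)
    (hT : ∀ (𝒰 : Ultrafilter ((S × S) × ℝ)) (u : S) (w : V),
      Tendsto (fun p : (S × S) × ℝ => p.1) 𝒰 (𝓝 (x, x)) →
      Tendsto (fun p : (S × S) × ℝ => p.2 • (p.1.1 - p.1.2)) 𝒰 (𝓝 u) →
      Tendsto (fun p : (S × S) × ℝ => p.2 • (h p.1.1 - h p.1.2)) 𝒰 (𝓝 w) → (u, w) ∈ T) :
    ∃ L : S →L[ℝ] V, HasStrictFDerivAt h L x := by
  have : ProperSpace S := FiniteDimensional.proper ℝ S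
  let P : T →ₗ[ℝ] S := (LinearMap.fst ℝ S V).comp T.subtype
  have hinj : Function.Injective P := by
    rw [← LinearMap.ker_eq_bot, LinearMap.ker_eq_bot']
    rintro ⟨⟨u, w⟩, hm⟩ h0
    have hu : u = 0 := h0
    subst hu
    ext1
    simp [hT0 w hm]
  have hsurj : Function.Surjective P := by
    intro u
    -- Difference quotients in direction `u` with increment `1/(n+1)`: a limit of them along an
    -- ultrafilter is a vector of `T` above `u`.
    let q : ℕ → (S × S) × ℝ := fun n => ((x + ((n : ℝ) + 1)⁻¹ • u, x), (n : ℝ) + 1)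
    let 𝒰 : Ultrafilter ((S × S) × ℝ) := (Ultrafilter.of (atTop : Filter ℕ)).map q
    have hle : ((Ultrafilter.of (atTop : Filter ℕ) : Ultrafilter ℕ) : Filter ℕ) ≤ atTop :=
      Ultrafilter.of_le _
    have h1 : Tendsto (fun p : (S × S) × ℝ => p.2 • (p.1.1 - p.1.2)) 𝒰 (𝓝 u) := by
      change Tendsto _ (map q _) _
      rw [tendsto_map'_iff]
      refine Tendsto.congr (f₁ := fun _ => u) (fun n => ?_) tendsto_const_nhds
      have : (n : ℝ) + 1 ≠ 0 := by positivity
      simp [q, smul_smul, this]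
    have h0 : Tendsto Prod.fst (𝒰 : Filter ((S × S) × ℝ)) (𝓝 (x, x)) := by
      change Tendsto _ (map q _) _
      rw [tendsto_map'_iff]
      refine Tendsto.mono_left ?_ hle
      refine Tendsto.prodMk_nhds ?_ tendsto_const_nhds
      have := ((tendsto_one_div_add_atTop_nhds_zero_nat (𝕜 := ℝ)).smul_const u).const_add x
      simpa [q] using this
    obtain ⟨w, hw⟩ := exists_tendsto_smul_sub_of_lipschitz hh 𝒰 h1
    exact ⟨⟨(u, w), hT 𝒰 u w h0 h1 hw⟩, rfl⟩
  let e : T ≃ₗ[ℝ] S := LinearEquiv.ofBijective P ⟨hinj, hsurj⟩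
  let L₀ : S →ₗ[ℝ] V := ((LinearMap.snd ℝ S V).comp T.subtype).comp e.symm.toLinearMap
  have hL₀ : ∀ u w, (u, w) ∈ T → w = L₀ u := by
    intro u w hm
    have : e ⟨(u, w), hm⟩ = u := rfl
    have h2 : e.symm u = ⟨(u, w), hm⟩ := e.symm_apply_eq.2 this.symm
    simp [L₀, h2]
  let L : S →L[ℝ] V := LinearMap.toContinuousLinearMap L₀
  refine ⟨L, HasStrictFDerivAt.of_isLittleO ?_⟩
  rw [isLittleO_iff]
  intro ε hε
  by_contra hcon
  -- An ultrafilter of pairs violating the estimate: normalized by their distance, these pairs have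
  -- limit quotients in `T`, the graph of `L`, which contradicts the gap `ε`.
  rw [not_eventually, frequently_iff_neBot] at hcon
  obtain ⟨𝒱, h𝒱⟩ := exists_ultrafilter_iff.2 hcon
  have hx : (𝒱 : Filter (S × S)) ≤ 𝓝 (x, x) := h𝒱.trans inf_le_left
  have hbad : ∀ᶠ p in (𝒱 : Filter (S × S)),
      ¬ ‖h p.1 - h p.2 - L (p.1 - p.2)‖ ≤ ε * ‖p.1 - p.2‖ :=
    h𝒱 (mem_inf_of_right (mem_principal_self _))
  let q : S × S → (S × S) × ℝ := fun p => (p, ‖p.1 - p.2‖⁻¹)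
  let 𝒰 : Ultrafilter ((S × S) × ℝ) := 𝒱.map q
  have hmem : Metric.closedBall (0 : S) 1 ∈
      𝒱.map (fun p => ‖p.1 - p.2‖⁻¹ • (p.1 - p.2)) := by
    change ∀ᶠ p in (𝒱 : Filter (S × S)), _
    refine Eventually.of_forall fun p => ?_
    rw [mem_closedBall_zero_iff, norm_smul, norm_inv, norm_norm]
    exact inv_mul_le_one
  obtain ⟨u, -, hu⟩ := (isCompact_closedBall (0 : S) 1).ultrafilter_le_nhds' _ hmem
  have hu' : Tendsto (fun p : S × S => ‖p.1 - p.2‖⁻¹ • (p.1 - p.2)) 𝒱 (𝓝 u) := hu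
  obtain ⟨w, hw⟩ := exists_tendsto_smul_sub_of_lipschitz hh 𝒱 hu'
  have hwL : w = L u := hL₀ u w <| hT 𝒰 u w
    (by change Tendsto _ (map q _) _; rw [tendsto_map'_iff]; exact hx)
    (by change Tendsto _ (map q _) _; rw [tendsto_map'_iff]; exact hu')
    (by change Tendsto _ (map q _) _; rw [tendsto_map'_iff]; exact hw)
  have hlim : Tendsto (fun p : S × S => ‖p.1 - p.2‖⁻¹ • (h p.1 - h p.2) -
      L (‖p.1 - p.2‖⁻¹ • (p.1 - p.2))) 𝒱 (𝓝 (w - L u)) :=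
    hw.sub ((L.continuous.tendsto u).comp hu')
  have hge : ∀ᶠ p in (𝒱 : Filter (S × S)), ε ≤ ‖‖p.1 - p.2‖⁻¹ • (h p.1 - h p.2) -
      L (‖p.1 - p.2‖⁻¹ • (p.1 - p.2))‖ := by
    filter_upwards [hbad] with p hp
    have hp0 : 0 < ‖p.1 - p.2‖ := by
      rw [norm_pos_iff]
      intro h0
      apply hp
      rw [sub_eq_zero] at h0
      simp [h0]
    rw [map_smul, ← smul_sub, norm_smul, norm_inv, norm_norm, inv_mul_eq_div, le_div_iff₀ hp0]
    exact (not_le.1 hp).le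
  have := ge_of_tendsto hlim.norm hge
  rw [hwL, sub_self, norm_zero] at this
  linarith

end StrictDerivative

/-! ### Iterates of a nonautonomous system and the growth scale -/

/-- The iterates `F (k - 1) ∘ ⋯ ∘ F 0` of a sequence of self-maps. -/
def iterSeq {X : Type*} (F : ℕ → X → X) : ℕ → X → X
  | 0, x => x
  | k + 1, x => F k (iterSeq F k x)

theorem iterSeq_succ' {X : Type*} (F : ℕ → X → X) (k : ℕ) (x : X) :
    iterSeq F (k + 1) x = iterSeq (fun j => F (j + 1)) k (F 0 x) := by
  induction k with
  | zero => rfl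
  | succ k ih => rw [iterSeq, ih, iterSeq]

theorem ContDiff.iterSeq {X : Type*} [NormedAddCommGroup X] [NormedSpace ℝ X] {F : ℕ → X → X}
    (hF : ∀ k, ContDiff ℝ 1 (F k)) (k : ℕ) : ContDiff ℝ 1 (iterSeq F k) := by
  induction k with
  | zero => exact contDiff_id
  | succ k ih => exact (hF k).comp ih

theorem iterSeq_add {X : Type*} (F : ℕ → X → X) (m k : ℕ) (x : X) :
    iterSeq (fun j => F (j + m)) k (iterSeq F m x) = iterSeq F (k + m) x := by
  induction k with
  | zero => rw [iterSeq, zero_add]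
  | succ k ih => rw [iterSeq, ih, Nat.add_right_comm, iterSeq]

/-- The product `∏_{j < k} (1 + β j)`. -/
def growth (β : ℕ → ℝ) (k : ℕ) : ℝ := ∏ j ∈ Finset.range k, (1 + β j)

theorem growth_succ (β : ℕ → ℝ) (k : ℕ) : growth β (k + 1) = growth β k * (1 + β k) :=
  Finset.prod_range_succ _ _

theorem growth_succ' (β : ℕ → ℝ) (k : ℕ) :
    growth β (k + 1) = growth (fun j => β (j + 1)) k * (1 + β 0) :=
  Finset.prod_range_succ' _ _

theorem growth_add (β : ℕ → ℝ) (m k : ℕ) :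
    growth β (k + m) = growth (fun j => β (j + m)) k * growth β m := by
  induction k with
  | zero => simp [growth]
  | succ k ih => rw [Nat.add_right_comm, growth_succ, ih, growth_succ]; ring

theorem one_add_sum_le_growth {β : ℕ → ℝ} (hβ : ∀ k, 0 ≤ β k) (k : ℕ) :
    1 + ∑ j ∈ Finset.range k, β j ≤ growth β k := by
  induction k with
  | zero => simp [growth]
  | succ k ih =>
    rw [growth_succ, Finset.sum_range_succ]
    have : 0 ≤ ∑ j ∈ Finset.range k, β j := Finset.sum_nonneg fun j _ => hβ j
    nlinarith [hβ k]

theorem one_le_growth {β : ℕ → ℝ} (hβ : ∀ k, 0 ≤ β k) (k : ℕ) : 1 ≤ growth β k := by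
  have : 0 ≤ ∑ j ∈ Finset.range k, β j := Finset.sum_nonneg fun j _ => hβ j
  linarith [one_add_sum_le_growth hβ k]

theorem tendsto_growth {β : ℕ → ℝ} (hβ : ∀ k, 0 ≤ β k) (hs : ¬ Summable β) :
    Tendsto (growth β) atTop atTop := by
  rw [not_summable_iff_tendsto_nat_atTop_of_nonneg hβ] at hs
  exact tendsto_atTop_mono (one_add_sum_le_growth hβ) (tendsto_atTop_add_const_left _ 1 hs)

theorem Prod.norm_sub_eq_fst {S V : Type*} [SeminormedAddCommGroup S] [SeminormedAddCommGroup V]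
    {z w : S × V} (h : ‖z.2 - w.2‖ ≤ ‖z.1 - w.1‖) :
    ‖z - w‖ = ‖z.1 - w.1‖ := by
  rw [Prod.norm_def]; exact max_eq_left h

theorem Prod.norm_sub_eq_snd {S V : Type*} [SeminormedAddCommGroup S] [SeminormedAddCommGroup V]
    {z w : S × V} (h : ‖z.1 - w.1‖ ≤ ‖z.2 - w.2‖) :
    ‖z - w‖ = ‖z.2 - w.2‖ := by
  rw [Prod.norm_def]; exact max_eq_right h

/-! ### Invariant cones and existence of slow orbits -/

section Saddle

variable {S V : Type*} [NormedAddCommGroup S] [NormedSpace ℝ S]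
  [NormedAddCommGroup V] [NormedSpace ℝ V]

/-- A `C¹` map of `S × V` fixing `0` that nearly does not expand the `S`-component, expands the
`V`-component, and whose preimages of graphs of `1`-Lipschitz maps project onto `S`. -/
structure IsSaddleStep (b : ℝ) (F : S × V → S × V) : Prop where
  contDiff : ContDiff ℝ 1 F
  map_zero : F 0 = 0
  norm_fst_le : ∀ z w, ‖(F z).1 - (F w).1‖ ≤ ‖z.1 - w.1‖ + b * ‖z - w‖
  le_norm_snd : ∀ z w, (1 + 4 * b) * ‖z.2 - w.2‖ ≤ ‖(F z).2 - (F w).2‖ + b * ‖z - w‖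
  exists_snd_eq : ∀ h : S → V, LipschitzWith 1 h → ∀ x, ∃ y, (F (x, y)).2 = h (F (x, y)).1

variable {b : ℝ} {F : S × V → S × V}

/-- In this cone the max norm is that of the second component, so the error costs one `b` and leaves
the factor `1 + 3b`. For `b ≤ 1` this is at least `(1 + b)²`, the square of the growth rate allowed
in the other cone; the constant `4` provides this gap. -/
theorem IsSaddleStep.cone_snd (hF : IsSaddleStep b F) (hb : 0 ≤ b) (hb1 : b ≤ 1) {z w : S × V}
    (h : ‖z.1 - w.1‖ ≤ ‖z.2 - w.2‖) :
    ‖(F z).1 - (F w).1‖ ≤ ‖(F z).2 - (F w).2‖ ∧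
      (1 + b) ^ 2 * ‖z.2 - w.2‖ ≤ ‖(F z).2 - (F w).2‖ := by
  have h1 := hF.norm_fst_le z w
  have h2 := hF.le_norm_snd z w
  rw [Prod.norm_sub_eq_snd h] at h1 h2
  have h3 := norm_nonneg (z.2 - w.2)
  have h4 : 0 ≤ b * ‖z.2 - w.2‖ := by positivity
  constructor
  · nlinarith
  · have : b * (b * ‖z.2 - w.2‖) ≤ 1 * (b * ‖z.2 - w.2‖) := by gcongr
    nlinarith

theorem IsSaddleStep.cone_fst (hF : IsSaddleStep b F) {z w : S × V}
    (h : ‖z.2 - w.2‖ ≤ ‖z.1 - w.1‖) : ‖(F z).1 - (F w).1‖ ≤ (1 + b) * ‖z - w‖ := by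
  have h1 := hF.norm_fst_le z w
  rw [Prod.norm_sub_eq_fst h] at h1 ⊢
  linarith

/-- Pairs of points mapped into the graph of a `1`-Lipschitz map were in the cone already. -/
theorem IsSaddleStep.cone_fst_of_image (hF : IsSaddleStep b F) (hb : 0 < b)
    {z w : S × V} (h : ‖(F z).2 - (F w).2‖ ≤ ‖(F z).1 - (F w).1‖) :
    ‖z.2 - w.2‖ ≤ ‖z.1 - w.1‖ := by
  by_contra! hlt
  have h1 := hF.norm_fst_le z w
  have h2 := hF.le_norm_snd z w
  rw [Prod.norm_sub_eq_snd hlt.le] at h1 h2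
  nlinarith [norm_nonneg (z.1 - w.1)]

theorem iterSeq_saddle_zero {β : ℕ → ℝ} {F : ℕ → S × V → S × V}
    (hF : ∀ k, IsSaddleStep (β k) (F k)) (k : ℕ) : iterSeq F k 0 = 0 := by
  induction k with
  | zero => rfl
  | succ k ih => rw [iterSeq, ih, (hF k).map_zero]

theorem iterSeq_cone_snd {β : ℕ → ℝ} (hβ : ∀ k, 0 < β k) (hβ1 : ∀ k, β k ≤ 1)
    {F : ℕ → S × V → S × V} (hF : ∀ k, IsSaddleStep (β k) (F k)) {z w : S × V}
    (h : ‖z.1 - w.1‖ ≤ ‖z.2 - w.2‖) (k : ℕ) :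
    ‖(iterSeq F k z).1 - (iterSeq F k w).1‖ ≤ ‖(iterSeq F k z).2 - (iterSeq F k w).2‖ ∧
      growth β k ^ 2 * ‖z.2 - w.2‖ ≤ ‖(iterSeq F k z).2 - (iterSeq F k w).2‖ := by
  induction k with
  | zero => simpa [iterSeq, growth] using h
  | succ k ih =>
    obtain ⟨h1, h2⟩ := (hF k).cone_snd (hβ k).le (hβ1 k) ih.1
    refine ⟨h1, ?_⟩
    rw [growth_succ, mul_pow, mul_comm (growth β k ^ 2), mul_assoc]
    exact (mul_le_mul_of_nonneg_left ih.2 (sq_nonneg _)).trans h2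

/-- Orbits whose difference grows at most like `growth β` keep their difference in the cone. -/
theorem norm_snd_le_of_slow {β : ℕ → ℝ} (hβ : ∀ k, 0 < β k) (hβ1 : ∀ k, β k ≤ 1)
    (hs : ¬ Summable β) {F : ℕ → S × V → S × V} (hF : ∀ k, IsSaddleStep (β k) (F k))
    {z w : S × V} {C : ℝ} (h : ∀ k, ‖iterSeq F k z - iterSeq F k w‖ ≤ C * growth β k) :
    ‖z.2 - w.2‖ ≤ ‖z.1 - w.1‖ := by
  by_contra! hlt
  have hpos : 0 < ‖z.2 - w.2‖ := (norm_nonneg _).trans_lt hlt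
  obtain ⟨k, hk⟩ := ((tendsto_growth (fun k => (hβ k).le) hs).eventually_gt_atTop
    (C / ‖z.2 - w.2‖)).exists
  have hg : 0 < growth β k := one_pos.trans_le (one_le_growth (fun k => (hβ k).le) k)
  have h1 := (iterSeq_cone_snd hβ hβ1 hF hlt.le k).2
  have h2 : ‖(iterSeq F k z).2 - (iterSeq F k w).2‖ ≤ C * growth β k :=
    (norm_snd_le (iterSeq F k z - iterSeq F k w)).trans (h k)
  rw [div_lt_iff₀ hpos] at hk
  have h3 := mul_lt_mul_of_pos_left hk hg
  nlinarith

/-- Backward graph transform: the zero graph at time `N` is pulled back step by step. The image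
pairs lie in the horizontal cone, hence so do the original ones, which keeps the Lipschitz constant
at `1`; in that cone each step expands by at most `1 + β k`. -/
theorem exists_lipschitz_finite_slow {β : ℕ → ℝ} (hβ : ∀ k, 0 < β k) (hβ1 : ∀ k, β k ≤ 1)
    {F : ℕ → S × V → S × V} (hF : ∀ k, IsSaddleStep (β k) (F k)) (N : ℕ) :
    ∃ h : S → V, LipschitzWith 1 h ∧ h 0 = 0 ∧
      ∀ x, ∀ j ≤ N, ‖iterSeq F j (x, h x)‖ ≤ growth β j * ‖x‖ := by
  induction N generalizing β F with
  | zero =>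
    refine ⟨fun _ => 0, LipschitzWith.const' 0, rfl, fun x j hj => ?_⟩
    obtain rfl : j = 0 := by omega
    simp [iterSeq, growth, Prod.norm_def]
  | succ N ih =>
    obtain ⟨h', hL', h0', hg'⟩ := ih (fun k => hβ (k + 1)) (fun k => hβ1 (k + 1))
      (fun k => hF (k + 1))
    choose h hh using (hF 0).exists_snd_eq h' hL'
    have hcone : ∀ x x' v v', (F 0 (x, v)).2 = h' (F 0 (x, v)).1 →
        (F 0 (x', v')).2 = h' (F 0 (x', v')).1 → ‖v - v'‖ ≤ ‖x - x'‖ := by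
      intro x x' v v' hv hv'
      refine (hF 0).cone_fst_of_image (z := (x, v)) (w := (x', v')) (hβ 0) ?_
      rw [hv, hv']
      simpa using hL'.norm_sub_le _ _
    have hL : ∀ x x', ‖h x - h x'‖ ≤ ‖x - x'‖ := fun x x' => hcone _ _ _ _ (hh x) (hh x')
    have h0 : h 0 = 0 := by
      have := hcone 0 0 (h 0) 0 (hh 0) (by
        rw [show ((0 : S), (0 : V)) = 0 from rfl, (hF 0).map_zero]; exact h0'.symm)
      simpa using this
    refine ⟨h, LipschitzWith.of_dist_le_mul fun x x' => ?_, h0, fun x j hj => ?_⟩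
    · simpa [dist_eq_norm] using hL x x'
    · have hx : ‖h x‖ ≤ ‖x‖ := by simpa [h0] using hL x 0
      cases j with
      | zero => simp [iterSeq, growth, Prod.norm_def, hx]
      | succ j =>
        rw [iterSeq_succ', growth_succ']
        have h1 := hg' (F 0 (x, h x)).1 j (by omega)
        rw [← hh x, Prod.mk.eta] at h1
        have h2 := (hF 0).cone_fst (z := (x, h x)) (w := 0) (by simpa using hx)
        rw [(hF 0).map_zero, sub_zero, Prod.fst_zero, sub_zero, Prod.norm_def,
          max_eq_left hx] at h2
        refine h1.trans ?_
        rw [mul_assoc]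
        exact mul_le_mul_of_nonneg_left h2
          (zero_le_one.trans (one_le_growth (fun k => (hβ (k + 1)).le) j))

/-- The finite-time solutions above `x` lie in a fixed ball, and a limit point inherits each bound
because every iterate is continuous. -/
theorem exists_slow [FiniteDimensional ℝ V] {β : ℕ → ℝ} (hβ : ∀ k, 0 < β k)
    (hβ1 : ∀ k, β k ≤ 1) {F : ℕ → S × V → S × V} (hF : ∀ k, IsSaddleStep (β k) (F k)) (x : S) :
    ∃ y : V, ∀ k, ‖iterSeq F k (x, y)‖ ≤ growth β k * ‖x‖ := by
  have : ProperSpace V := FiniteDimensional.proper ℝ V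
  choose h hL h0 hg using exists_lipschitz_finite_slow hβ hβ1 hF
  have hmem : ∀ N, h N x ∈ Metric.closedBall (0 : V) ‖x‖ := fun N => by
    simpa [h0] using (hL N).norm_sub_le x 0
  obtain ⟨y, -, φ, hφ, hy⟩ := (isCompact_closedBall (0 : V) ‖x‖).tendsto_subseq hmem
  refine ⟨y, fun k => ?_⟩
  have hc : Continuous (iterSeq F k) := (ContDiff.iterSeq (fun k => (hF k).contDiff) k).continuous
  have hlim : Tendsto (fun n => ‖iterSeq F k (x, h (φ n) x)‖) atTop
      (𝓝 ‖iterSeq F k (x, y)‖) :=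
    ((hc.tendsto (x, y)).comp (tendsto_const_nhds.prodMk_nhds hy)).norm
  refine le_of_tendsto hlim ?_
  filter_upwards [eventually_ge_atTop k] with n hn
  exact hg (φ n) x k (hn.trans (hφ.id_le n))

end Saddle

/-! ### The slow set is a `C¹` graph -/

theorem HasStrictFDerivAt.tendsto_smul_sub {X Y ι : Type*} [NormedAddCommGroup X]
    [NormedSpace ℝ X] [NormedAddCommGroup Y] [NormedSpace ℝ Y] {f : X → Y} {f' : X →L[ℝ] Y}
    {z : X} (hf : HasStrictFDerivAt f f' z) {l : Filter ι} {a b : ι → X} {t : ι → ℝ} {v : X}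
    (hab : Tendsto (fun i => (a i, b i)) l (𝓝 (z, z)))
    (hv : Tendsto (fun i => t i • (a i - b i)) l (𝓝 v)) :
    Tendsto (fun i => t i • (f (a i) - f (b i))) l (𝓝 (f' v)) := by
  have h1 := hf.isLittleO.comp_tendsto hab
  have h2 : (fun i => t i • (f (a i) - f (b i) - f' (a i - b i))) =o[l]
      fun i => t i • (a i - b i) := (isBigO_refl t l).smul_isLittleO h1
  have h3 : Tendsto (fun i => t i • (f (a i) - f (b i) - f' (a i - b i))) l (𝓝 0) :=
    (isLittleO_one_iff ℝ).1 (h2.trans_isBigO (hv.isBigO_one ℝ))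
  have h4 := h3.add ((f'.continuous.tendsto v).comp hv)
  rw [zero_add] at h4
  refine h4.congr fun i => ?_
  simp [smul_sub]

section Saddle

variable {S V : Type*} [NormedAddCommGroup S] [NormedSpace ℝ S]
  [NormedAddCommGroup V] [NormedSpace ℝ V]
  {β : ℕ → ℝ} {F : ℕ → S × V → S × V}

/-- The tail of the system from time `k` is again a saddle system, and slowness passes to it with
constant `C * growth β k`. -/
theorem norm_snd_iterSeq_le_of_slow (hβ : ∀ k, 0 < β k) (hβ1 : ∀ k, β k ≤ 1)
    (hs : ¬ Summable β) (hF : ∀ k, IsSaddleStep (β k) (F k))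
    {z w : S × V} {C : ℝ} (h : ∀ k, ‖iterSeq F k z - iterSeq F k w‖ ≤ C * growth β k) (k : ℕ) :
    ‖(iterSeq F k z).2 - (iterSeq F k w).2‖ ≤ ‖(iterSeq F k z).1 - (iterSeq F k w).1‖ := by
  refine norm_snd_le_of_slow (β := fun j => β (j + k)) (F := fun j => F (j + k))
    (C := C * growth β k) (fun j => hβ _) (fun j => hβ1 _) (mt (summable_nat_add_iff k).1 hs)
    (fun j => hF _) fun j => ?_
  rw [iterSeq_add, iterSeq_add, mul_assoc, mul_comm (growth β k), ← growth_add]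
  exact h _

/-- Replaces an arbitrary `C` by `‖z - w‖`; this homogeneity lets the bound pass to limits of
difference quotients. -/
theorem norm_iterSeq_sub_le_of_slow (hβ : ∀ k, 0 < β k) (hβ1 : ∀ k, β k ≤ 1)
    (hs : ¬ Summable β) (hF : ∀ k, IsSaddleStep (β k) (F k))
    {z w : S × V} {C : ℝ} (h : ∀ k, ‖iterSeq F k z - iterSeq F k w‖ ≤ C * growth β k) (k : ℕ) :
    ‖iterSeq F k z - iterSeq F k w‖ ≤ growth β k * ‖z - w‖ := by
  have hcone := norm_snd_iterSeq_le_of_slow hβ hβ1 hs hF h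
  induction k with
  | zero => simp [iterSeq, growth]
  | succ k ih =>
    have h1 := (hF k).cone_fst (hcone k)
    rw [Prod.norm_sub_eq_fst (hcone (k + 1)), growth_succ, mul_comm (growth β k), mul_assoc]
    exact h1.trans (mul_le_mul_of_nonneg_left ih (by linarith [hβ k]))

/-- Tangent vectors at `z` along which the iterates grow at most like `growth β`. -/
def slowTangent (β : ℕ → ℝ) (F : ℕ → S × V → S × V) (z : S × V) :
    Submodule ℝ (S × V) where
  carrier := {v | ∃ C, ∀ k, ‖fderiv ℝ (iterSeq F k) z v‖ ≤ C * growth β k}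
  zero_mem' := ⟨0, fun k => by simp⟩
  add_mem' := by
    rintro v w ⟨C, hC⟩ ⟨D, hD⟩
    refine ⟨C + D, fun k => ?_⟩
    rw [map_add, add_mul]
    exact (norm_add_le _ _).trans (add_le_add (hC k) (hD k))
  smul_mem' := by
    rintro c v ⟨C, hC⟩
    refine ⟨‖c‖ * C, fun k => ?_⟩
    rw [map_smul, norm_smul, mul_assoc]
    exact mul_le_mul_of_nonneg_left (hC k) (norm_nonneg _)

/-- Vertical difference quotients grow at least like `growth β k ^ 2`, and so does the derivative
along a vertical vector; a slow one must vanish. -/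
theorem eq_zero_of_mem_slowTangent (hβ : ∀ k, 0 < β k) (hβ1 : ∀ k, β k ≤ 1)
    (hs : ¬ Summable β) (hF : ∀ k, IsSaddleStep (β k) (F k)) {z : S × V} {w : V}
    (hw : ((0 : S), w) ∈ slowTangent β F z) : w = 0 := by
  obtain ⟨C, hC⟩ := hw
  have hC1 : ∀ k, growth β k ^ 2 * ‖w‖ ≤ C * growth β k := by
    intro k
    refine le_trans ?_ (hC k)
    have hd : HasFDerivAt (iterSeq F k) (fderiv ℝ (iterSeq F k) z) z :=
      ((ContDiff.iterSeq (fun k => (hF k).contDiff) k).differentiable one_ne_zero z).hasFDerivAt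
    refine ge_of_tendsto (hd.lim_real ((0 : S), w)).norm ?_
    filter_upwards [eventually_gt_atTop 0] with c hc
    have h1 := (iterSeq_cone_snd hβ hβ1 hF (z := z + c⁻¹ • ((0 : S), w)) (w := z)
      (by simp) k).2
    have h2 : ‖(z + c⁻¹ • ((0 : S), w)).2 - z.2‖ = c⁻¹ * ‖w‖ := by
      simp [norm_smul, abs_of_pos hc]
    rw [h2] at h1
    have h3 := h1.trans (norm_snd_le (iterSeq F k (z + c⁻¹ • ((0 : S), w)) - iterSeq F k z))
    rw [norm_smul, Real.norm_of_nonneg hc.le]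
    calc growth β k ^ 2 * ‖w‖ = c * (growth β k ^ 2 * (c⁻¹ * ‖w‖)) := by field_simp
      _ ≤ _ := mul_le_mul_of_nonneg_left h3 hc.le
  by_contra hne
  have hpos : 0 < ‖w‖ := norm_pos_iff.2 hne
  obtain ⟨k, hk⟩ := ((tendsto_growth (fun k => (hβ k).le) hs).eventually_gt_atTop
    (C / ‖w‖)).exists
  have hg : 0 < growth β k := one_pos.trans_le (one_le_growth (fun k => (hβ k).le) k)
  rw [div_lt_iff₀ hpos] at hk
  nlinarith [hC1 k, mul_lt_mul_of_pos_left hk hg]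

/-- The points whose orbit grows at most like `growth β` form the graph of a `C¹` map. -/
theorem exists_contDiff_slow_graph [FiniteDimensional ℝ S] [FiniteDimensional ℝ V]
    (hβ : ∀ k, 0 < β k) (hβ1 : ∀ k, β k ≤ 1) (hs : ¬ Summable β)
    (hF : ∀ k, IsSaddleStep (β k) (F k)) :
    ∃ h : S → V, ContDiff ℝ 1 h ∧ h 0 = 0 ∧
      (∀ z C, (∀ k, ‖iterSeq F k z‖ ≤ C * growth β k) → z.2 = h z.1) ∧
      ∀ x k, ‖(iterSeq F k (x, h x)).2‖ ≤ ‖(iterSeq F k (x, h x)).1‖ := by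
  choose h hh using exists_slow hβ hβ1 hF
  have hdiff : ∀ {z w : S × V} {C D : ℝ}, (∀ k, ‖iterSeq F k z‖ ≤ C * growth β k) →
      (∀ k, ‖iterSeq F k w‖ ≤ D * growth β k) →
      ∀ k, ‖iterSeq F k z - iterSeq F k w‖ ≤ (C + D) * growth β k := by
    intro z w C D hz hw k
    rw [add_mul]
    exact (norm_sub_le _ _).trans (add_le_add (hz k) (hw k))
  have hgr : ∀ x k, ‖iterSeq F k (x, h x)‖ ≤ ‖x‖ * growth β k := fun x k => by
    rw [mul_comm]; exact hh x k
  have hzero : ∀ k, ‖iterSeq F k (0 : S × V)‖ ≤ 0 * growth β k := fun k => by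
    simp [iterSeq_saddle_zero hF]
  have hL : LipschitzWith 1 h := LipschitzWith.of_dist_le_mul fun x x' => by
    simpa [dist_eq_norm, iterSeq] using
      norm_snd_iterSeq_le_of_slow hβ hβ1 hs hF (hdiff (hgr x) (hgr x')) 0
  have huniq : ∀ z C, (∀ k, ‖iterSeq F k z‖ ≤ C * growth β k) → z.2 = h z.1 := by
    intro z C hz
    have := norm_snd_iterSeq_le_of_slow hβ hβ1 hs hF (hdiff hz (hgr z.1)) 0
    simpa [iterSeq, sub_eq_zero] using this
  refine ⟨h, contDiff_one_of_hasStrictFDerivAt fun x => ?_, (huniq 0 0 hzero).symm, huniq,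
    fun x k => ?_⟩
  · refine exists_hasStrictFDerivAt_of_tangent hL x (slowTangent β F (x, h x))
      (fun w hw => eq_zero_of_mem_slowTangent hβ hβ1 hs hF hw) ?_
    intro 𝒰 u w h0 hu hw
    refine ⟨‖((u, w) : S × V)‖, fun k => ?_⟩
    have hd : HasStrictFDerivAt (iterSeq F k) (fderiv ℝ (iterSeq F k) (x, h x)) (x, h x) :=
      (ContDiff.iterSeq (fun k => (hF k).contDiff) k).contDiffAt.hasStrictFDerivAt one_ne_zero
    let a : (S × S) × ℝ → S × V := fun p => (p.1.1, h p.1.1)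
    let b : (S × S) × ℝ → S × V := fun p => (p.1.2, h p.1.2)
    have hc : Continuous fun q : S × S => ((q.1, h q.1), (q.2, h q.2)) := by
      have := hL.continuous
      fun_prop
    have hab : Tendsto (fun p => (a p, b p)) 𝒰 (𝓝 ((x, h x), (x, h x))) :=
      (hc.tendsto (x, x)).comp h0
    have hv : Tendsto (fun p => p.2 • (a p - b p)) 𝒰 (𝓝 (u, w)) := hu.prodMk_nhds hw
    have hlim := hd.tendsto_smul_sub hab hv
    rw [mul_comm]
    refine le_of_tendsto_of_tendsto' hlim.norm (hv.norm.const_mul (growth β k)) fun p => ?_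
    rw [norm_smul, norm_smul, mul_left_comm]
    exact mul_le_mul_of_nonneg_left
      (norm_iterSeq_sub_le_of_slow hβ hβ1 hs hF (hdiff (hgr p.1.1) (hgr p.1.2)) k)
      (norm_nonneg _)
  · simpa [iterSeq_saddle_zero hF] using
      norm_snd_iterSeq_le_of_slow hβ hβ1 hs hF (hdiff (hgr x) hzero) k

/-- A map `(x, y) ↦ (A x, B y)` with `A` nonexpansive and `B` expanding, perturbed by a map with
small Lipschitz constant. -/
theorem isSaddleStep_of_lipschitz [FiniteDimensional ℝ V] {b : ℝ} (hb : 0 < b)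
    (A : S →L[ℝ] S) (B : V →L[ℝ] V) (hA : ∀ x, ‖A x‖ ≤ ‖x‖)
    (hB : ∀ y, (1 + 4 * b) * ‖y‖ ≤ ‖B y‖) (hBs : Function.Surjective B)
    {r : S × V → S × V} (hr : ContDiff ℝ 1 r) (hr0 : r 0 = 0)
    (hrL : ∀ z w, ‖r z - r w‖ ≤ b * ‖z - w‖) :
    IsSaddleStep b fun z => (A z.1, B z.2) + r z where
  contDiff := by fun_prop
  map_zero := by simp [hr0]
  norm_fst_le z w := by
    have h1 := (norm_fst_le (r z - r w)).trans (hrL z w)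
    have h2 := hA (z.1 - w.1)
    have h3 : (((A z.1, B z.2) + r z).1 - ((A w.1, B w.2) + r w).1 : S) =
        A (z.1 - w.1) + (r z - r w).1 := by simp; abel
    rw [h3]
    exact (norm_add_le _ _).trans (add_le_add h2 h1)
  le_norm_snd z w := by
    have h1 := (norm_snd_le (r z - r w)).trans (hrL z w)
    have h2 := hB (z.2 - w.2)
    have h3 : B (z.2 - w.2) = (((A z.1, B z.2) + r z).2 - ((A w.1, B w.2) + r w).2) -
        (r z - r w).2 := by simp; abel
    rw [h3] at h2
    exact h2.trans ((norm_sub_le _ _).trans (add_le_add le_rfl h1))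
  exists_snd_eq h hh x := by
    have : CompleteSpace V := FiniteDimensional.complete ℝ V
    choose Bi hBi using hBs
    -- The equation reads `B y = h (A x + r₁) - r₂`. Since `B⁻¹` has norm at most `1 / (1 + 4b)` and
    -- the right side is `2b`-Lipschitz in `y`, `φ` contracts by `1/2`.
    let φ : V → V := fun y => Bi (h (A x + (r (x, y)).1) - (r (x, y)).2)
    have hφ : ContractingWith (1 / 2) φ := by
      refine ⟨by rw [← NNReal.coe_lt_coe]; norm_num, LipschitzWith.of_dist_le_mul fun y y' => ?_⟩
      rw [dist_eq_norm, dist_eq_norm]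
      have h1 := hB (φ y - φ y')
      have h2 : B (φ y - φ y') = (h (A x + (r (x, y)).1) - h (A x + (r (x, y')).1)) -
          (r (x, y) - r (x, y')).2 := by
        rw [map_sub, hBi, hBi, Prod.snd_sub]; abel
      have h3 := hrL (x, y) (x, y')
      have h4 : ‖((x, y) : S × V) - (x, y')‖ = ‖y - y'‖ := by simp [Prod.norm_def]
      have h5 := hh.norm_sub_le (A x + (r (x, y)).1) (A x + (r (x, y')).1)
      rw [add_sub_add_left_eq_sub, NNReal.coe_one, one_mul, ← Prod.fst_sub] at h5
      have h6 := norm_fst_le (r (x, y) - r (x, y'))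
      have h7 := norm_snd_le (r (x, y) - r (x, y'))
      have h8 := norm_sub_le (h (A x + (r (x, y)).1) - h (A x + (r (x, y')).1))
        (r (x, y) - r (x, y')).2
      rw [h2] at h1
      rw [h4] at h3
      have h9 : (1 + 4 * b) * ‖φ y - φ y'‖ ≤ 2 * b * ‖y - y'‖ := by linarith
      have h10 : (1 + 4 * b) * ‖φ y - φ y'‖ ≤ (1 + 4 * b) * (1 / 2 * ‖y - y'‖) := by
        nlinarith [norm_nonneg (y - y')]
      simpa using le_of_mul_le_mul_left h10 (by linarith)
    refine ⟨ContractingWith.fixedPoint φ hφ, ?_⟩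
    have h1 := congrArg B (ContractingWith.fixedPoint_isFixedPt hφ).eq
    change B (Bi _) = _ at h1
    rw [hBi] at h1
    set y := ContractingWith.fixedPoint φ hφ
    change B y + (r (x, y)).2 = h (A x + (r (x, y)).1)
    rw [← h1, sub_add_cancel]

end Saddle

/-- If the first component is contracted up to a perturbation of size `β`,
orbits that stay in the cone tend to `0` monotonically. -/
theorem tendsto_iterSeq_of_cone {S V : Type*} [NormedAddCommGroup S]
    [NormedAddCommGroup V] {β : ℕ → ℝ} {F : ℕ → S × V → S × V}
    (hβ : ∀ k, 0 < β k) (hs : ¬ Summable β) {z : S × V}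
    (hcone : ∀ k, ‖(iterSeq F k z).2‖ ≤ ‖(iterSeq F k z).1‖)
    (hcontr : ∀ k w, ‖(F k w).1‖ ≤ (1 - 4 * β k) * ‖w.1‖ + β k * ‖w‖) :
    (∀ k, ‖iterSeq F k z‖ ≤ ‖z‖) ∧ Tendsto (fun k => iterSeq F k z) atTop (𝓝 0) := by
  have hnorm : ∀ k, ‖iterSeq F k z‖ = ‖(iterSeq F k z).1‖ := fun k => max_eq_left (hcone k)
  have hstep : ∀ k, ‖iterSeq F (k + 1) z‖ ≤ (1 - 3 * β k) * ‖iterSeq F k z‖ := by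
    intro k
    have h1 := hcontr k (iterSeq F k z)
    rw [← hnorm k] at h1
    rw [hnorm (k + 1)]
    exact h1.trans (by linarith)
  have hdec : ∀ k, growth β k * ‖iterSeq F k z‖ ≤ ‖z‖ := by
    intro k
    induction k with
    | zero => simp [growth, iterSeq]
    | succ k ih =>
      have hg : 0 ≤ growth β k := zero_le_one.trans (one_le_growth (fun k => (hβ k).le) k)
      -- Uses `(1 + β)(1 - 3β) ≤ 1`, so that `growth β k * ‖z_k‖` is nonincreasing.
      have h1 : (1 + β k) * ‖iterSeq F (k + 1) z‖ ≤ ‖iterSeq F k z‖ := by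
        have := mul_le_mul_of_nonneg_left (hstep k) (by linarith [hβ k] : 0 ≤ 1 + β k)
        nlinarith [norm_nonneg (iterSeq F k z), hβ k,
          mul_nonneg (hβ k).le (norm_nonneg (iterSeq F k z)),
          mul_nonneg (sq_nonneg (β k)) (norm_nonneg (iterSeq F k z))]
      rw [growth_succ, mul_assoc]
      exact (mul_le_mul_of_nonneg_left h1 hg).trans ih
  have hg1 := one_le_growth (fun k => (hβ k).le)
  refine ⟨fun k => ?_, ?_⟩
  · exact (le_mul_of_one_le_left (norm_nonneg _) (hg1 k)).trans (hdec k)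
  · rw [tendsto_zero_iff_norm_tendsto_zero]
    refine squeeze_zero (fun _ => norm_nonneg _) (g := fun k => ‖z‖ / growth β k) (fun k => ?_)
      ((tendsto_growth (fun k => (hβ k).le) hs).const_div_atTop _)
    rw [le_div_iff₀ (one_pos.trans_le (hg1 k)), mul_comm]
    exact hdec k

/-! ### Eigencoordinates, cutoff and submanifold charts -/

section Splitting

variable {d : ℕ} (p : Fin d → Prop) [DecidablePred p]

/-- Splitting the coordinates of a vector according to a predicate. -/
def piSplit : (Fin d → ℝ) ≃ₗ[ℝ] ({i // p i} → ℝ) × ({i // ¬ p i} → ℝ) where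
  __ := Equiv.piEquivPiSubtypeProd p fun _ => ℝ
  map_add' _ _ := rfl
  map_smul' _ _ := rfl

theorem piSplit_symm_apply_neg (z : ({i // p i} → ℝ) × ({i // ¬ p i} → ℝ)) {i : Fin d}
    (hi : ¬ p i) : (piSplit p).symm z i = z.2 ⟨i, hi⟩ := by
  conv_rhs => rw [← (piSplit p).apply_symm_apply z]
  rfl

/-- The coordinates satisfying `p` can be placed before all the others. -/
theorem exists_coordinate_equiv :
    ∃ R : (({i // p i} → ℝ) × ({i // ¬ p i} → ℝ)) ≃L[ℝ] EuclideanSpace ℝ (Fin d),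
      ∀ z, z.2 = 0 ↔ ∀ i : Fin d, Fintype.card {i // p i} ≤ (i : ℕ) → R z i = 0 := by
  classical
  have hle : Fintype.card {i // p i} ≤ d := by simpa using Fintype.card_subtype_le p
  have hcard : Fintype.card {i // p i} =
      Fintype.card {i : Fin d // (i : ℕ) < Fintype.card {i // p i}} := by
    rw [Fintype.card_subtype (fun i : Fin d => (i : ℕ) < Fintype.card {i // p i}),
      Fin.card_filter_val_lt, min_eq_right hle]
  -- A bijection between two subsets of equal cardinality of a finite type extends to a permutation.
  let σ : Equiv.Perm (Fin d) := (Fintype.equivOfCardEq hcard).extendSubtype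
  have hσ : ∀ i, p i → (σ i : ℕ) < Fintype.card {i // p i} := fun i hi =>
    Equiv.extendSubtype_mem (Fintype.equivOfCardEq hcard) i hi
  have hσ' : ∀ i, ¬ p i → ¬ (σ i : ℕ) < Fintype.card {i // p i} := fun i hi =>
    Equiv.extendSubtype_not_mem (Fintype.equivOfCardEq hcard) i hi
  let R := ((piSplit p).symm.trans ((LinearEquiv.funCongrLeft ℝ ℝ σ.symm).trans
    (WithLp.linearEquiv 2 ℝ (Fin d → ℝ)).symm)).toContinuousLinearEquiv
  have hR : ∀ z i, R z (σ i) = (piSplit p).symm z i := fun z i => by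
    change (piSplit p).symm z (σ.symm (σ i)) = _
    rw [σ.symm_apply_apply]
  refine ⟨R, fun z => ⟨fun h0 i hi => ?_, fun h0 => ?_⟩⟩
  · obtain ⟨j, rfl⟩ := σ.surjective i
    have hj : ¬ p j := fun hj => (hσ j hj).not_ge hi
    rw [hR, piSplit_symm_apply_neg p z hj, h0]
    rfl
  · funext ⟨j, hj⟩
    have := h0 (σ j) (not_lt.1 (hσ' j hj))
    rwa [hR, piSplit_symm_apply_neg p z hj] at this

end Splitting

/-- Coordinates adapted to a diagonalizable matrix, with the nonnegative part of the spectrum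
separated from the negative part. -/
theorem IsRealDiagonalizable.exists_splitting {d : ℕ} {G : Matrix (Fin d) (Fin d) ℝ}
    (hG : IsRealDiagonalizable G) :
    ∃ (l : Fin d → ℝ) (T : EuclideanSpace ℝ (Fin d) ≃L[ℝ]
        ({i // 0 ≤ l i} → ℝ) × ({i // ¬ 0 ≤ l i} → ℝ)),
      (∀ v, T (Matrix.toEuclideanCLM (𝕜 := ℝ) G v) =
        (fun i => l i.1 * (T v).1 i, fun i => l i.1 * (T v).2 i)) ∧
      (∀ μ, Module.End.HasEigenvalue (Matrix.toLin' G) μ → ∃ i, l i = μ) ∧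
      (IsUnit G.det → ∀ i, l i ≠ 0) := by
  obtain ⟨Q, l, hQ, rfl⟩ := hG
  have hQQ : Q * Q⁻¹ = 1 := Matrix.mul_nonsing_inv Q hQ
  have hQQ' : Q⁻¹ * Q = 1 := Matrix.nonsing_inv_mul Q hQ
  let q : (Fin d → ℝ) ≃ₗ[ℝ] (Fin d → ℝ) :=
    LinearEquiv.ofLinearMap (Matrix.toLin' Q) (Matrix.toLin' Q⁻¹)
      (by rw [← Matrix.toLin'_mul, hQQ, Matrix.toLin'_one])
      (by rw [← Matrix.toLin'_mul, hQQ', Matrix.toLin'_one])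
  have hq : ∀ v, q ((Q⁻¹ * Matrix.diagonal l * Q).mulVec v) = fun i => l i * q v i := by
    intro v
    change Q.mulVec _ = fun i => l i * Q.mulVec v i
    rw [Matrix.mulVec_mulVec, ← mul_assoc, ← mul_assoc, hQQ, one_mul, ← Matrix.mulVec_mulVec]
    funext i
    rw [Matrix.mulVec_diagonal]
  refine ⟨l, (((WithLp.linearEquiv 2 ℝ (Fin d → ℝ)).trans q).trans
    (piSplit fun i => 0 ≤ l i)).toContinuousLinearEquiv, fun v => ?_, fun μ hμ => ?_,
    fun hdet i hi => ?_⟩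
  · change piSplit _ (q ((Matrix.toEuclideanCLM (𝕜 := ℝ)
      (Q⁻¹ * Matrix.diagonal l * Q) v).ofLp)) = _
    rw [Matrix.ofLp_toEuclideanCLM, hq]
    rfl
  · obtain ⟨v, hv⟩ := hμ.exists_hasEigenvector
    have h1 := hv.apply_eq_smul
    rw [Matrix.toLin'_apply] at h1
    have h2 := hq v
    rw [h1, map_smul] at h2
    have h3 : q v ≠ 0 := by simpa using hv.2
    obtain ⟨i, hi⟩ := Function.ne_iff.1 h3
    exact ⟨i, (mul_right_cancel₀ hi (congrFun h2 i)).symm⟩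
  · rw [Matrix.det_mul, Matrix.det_mul, Matrix.det_diagonal,
      Finset.prod_eq_zero (Finset.mem_univ i) hi] at hdet
    simp at hdet

/-- Multiplication by a smooth cutoff makes a Lipschitz bound near a zero global. -/
theorem exists_lipschitz_cutoff (E : Type*) [NormedAddCommGroup E] [InnerProductSpace ℝ E]
    [FiniteDimensional ℝ E] :
    ∃ C : ℝ, 0 < C ∧ ∀ (p : E) (δ : ℝ), 0 < δ → ∃ χ : E → ℝ, ContDiff ℝ 1 χ ∧
      (∀ u ∈ Metric.ball p (δ / 2), χ u = 1) ∧
      ∀ (θ : E → E) (L : ℝ), 0 ≤ L → θ p = 0 →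
        (∀ u ∈ Metric.ball p δ, ∀ v ∈ Metric.ball p δ, ‖θ u - θ v‖ ≤ L * ‖u - v‖) →
        ∀ u v, ‖χ u • θ u - χ v • θ v‖ ≤ C * L * ‖u - v‖ := by
  let χ₀ : ContDiffBump (0 : E) := ⟨1 / 2, 1, by norm_num, by norm_num⟩
  obtain ⟨K, hK⟩ := ContDiff.lipschitzWith_of_hasCompactSupport (n := 1) χ₀.hasCompactSupport
    χ₀.contDiff one_ne_zero
  refine ⟨1 + K, by positivity, fun p δ hδ => ⟨fun u => χ₀ (δ⁻¹ • (u - p)), ?_, ?_, ?_⟩⟩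
  · exact χ₀.contDiff.comp (contDiff_const.smul (contDiff_id.sub contDiff_const))
  · intro u hu
    refine χ₀.one_of_mem_closedBall ?_
    rw [mem_closedBall_zero_iff, norm_smul, norm_inv, Real.norm_of_nonneg hδ.le,
      inv_mul_le_iff₀ hδ]
    rw [mem_ball_iff_norm] at hu
    change _ ≤ δ * (1 / 2)
    linarith
  · intro θ L hL hp hθ
    have hout : ∀ u ∉ Metric.ball p δ, χ₀ (δ⁻¹ • (u - p)) = 0 := by
      intro u hu
      refine χ₀.zero_of_le_dist ?_
      rw [Metric.mem_ball, not_lt, dist_eq_norm] at hu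
      rw [dist_zero_right, norm_smul, norm_inv, Real.norm_of_nonneg hδ.le, inv_mul_eq_div]
      exact (le_div_iff₀ hδ).2 (by rw [one_mul]; exact hu)
    have hχ : ∀ u v : E, |χ₀ (δ⁻¹ • (u - p)) - χ₀ (δ⁻¹ • (v - p))| ≤ K * (δ⁻¹ * ‖u - v‖) := by
      intro u v
      have := hK.norm_sub_le (δ⁻¹ • (u - p)) (δ⁻¹ • (v - p))
      rwa [← smul_sub, sub_sub_sub_cancel_right, norm_smul, norm_inv,
        Real.norm_of_nonneg hδ.le] at this
    have hp' : p ∈ Metric.ball p δ := Metric.mem_ball_self hδ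
    have key : ∀ u, ∀ v ∈ Metric.ball p δ,
        ‖χ₀ (δ⁻¹ • (u - p)) • θ u - χ₀ (δ⁻¹ • (v - p)) • θ v‖ ≤ (1 + K) * L * ‖u - v‖ := by
      intro u v hv
      have hθv : ‖θ v‖ ≤ L * ‖v - p‖ := by simpa [hp] using hθ v hv p hp'
      have hvδ : ‖v - p‖ < δ := mem_ball_iff_norm.1 hv
      have h1 : ‖χ₀ (δ⁻¹ • (u - p)) • (θ u - θ v)‖ ≤ L * ‖u - v‖ := by
        by_cases hu : u ∈ Metric.ball p δ
        · rw [norm_smul, Real.norm_of_nonneg χ₀.nonneg]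
          exact (mul_le_of_le_one_left (norm_nonneg _) χ₀.le_one).trans (hθ u hu v hv)
        · rw [hout u hu, zero_smul, norm_zero]
          positivity
      -- The cutoff has slope of order `1/δ` while `θ v` is of size at most `L * δ`, so `δ` cancels
      -- and the final constant does not depend on the radius.
      have h2 : ‖(χ₀ (δ⁻¹ • (u - p)) - χ₀ (δ⁻¹ • (v - p))) • θ v‖ ≤ K * (L * ‖u - v‖) := by
        rw [norm_smul, Real.norm_eq_abs]
        calc _ ≤ K * (δ⁻¹ * ‖u - v‖) * (L * δ) :=
              mul_le_mul (hχ u v) (hθv.trans (mul_le_mul_of_nonneg_left hvδ.le hL))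
                (norm_nonneg _) (by positivity)
          _ = K * (L * ‖u - v‖) := by field_simp
      have h3 : χ₀ (δ⁻¹ • (u - p)) • θ u - χ₀ (δ⁻¹ • (v - p)) • θ v =
          χ₀ (δ⁻¹ • (u - p)) • (θ u - θ v) +
            (χ₀ (δ⁻¹ • (u - p)) - χ₀ (δ⁻¹ • (v - p))) • θ v := by
        module
      rw [h3]
      exact (norm_add_le _ _).trans ((add_le_add h1 h2).trans_eq (by ring))
    intro u v
    by_cases hv : v ∈ Metric.ball p δ
    · exact key u v hv
    by_cases hu : u ∈ Metric.ball p δ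
    · have := key v u hu
      rwa [norm_sub_rev, norm_sub_rev v u] at this
    · change ‖χ₀ (δ⁻¹ • (u - p)) • θ u - χ₀ (δ⁻¹ • (v - p)) • θ v‖ ≤ _
      rw [hout u hu, hout v hv, zero_smul, zero_smul, sub_zero, norm_zero]
      positivity

/-- The zero set of a submersion, in coordinates straightened by an equivalence `R`. -/
theorem exists_isC1Submanifold {d m : ℕ} (hm : m ≤ d) {S V : Type*}
    [NormedAddCommGroup S] [NormedSpace ℝ S] [NormedAddCommGroup V] [NormedSpace ℝ V]
    (R : (S × V) ≃L[ℝ] EuclideanSpace ℝ (Fin d))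
    (hR : ∀ z, z.2 = 0 ↔ ∀ i : Fin d, m ≤ (i : ℕ) → R z i = 0)
    {q : EuclideanSpace ℝ (Fin d) → S × V} (hq : ContDiff ℝ 1 q)
    {p : EuclideanSpace ℝ (Fin d)} (hinj : Function.Injective (fderiv ℝ q p)) :
    ∃ O : Set (EuclideanSpace ℝ (Fin d)), IsOpen O ∧ p ∈ O ∧
      ∀ U ⊆ O, IsOpen U → IsC1Submanifold m {x ∈ U | (q x).2 = 0} := by
  let M : EuclideanSpace ℝ (Fin d) →L[ℝ] EuclideanSpace ℝ (Fin d) :=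
    (R : S × V →L[ℝ] EuclideanSpace ℝ (Fin d)).comp (fderiv ℝ q p)
  have hM : Function.Injective M := R.injective.comp hinj
  let e : EuclideanSpace ℝ (Fin d) ≃L[ℝ] EuclideanSpace ℝ (Fin d) :=
    (LinearEquiv.ofInjectiveEndo M.toLinearMap hM).toContinuousLinearEquiv
  let f : EuclideanSpace ℝ (Fin d) → EuclideanSpace ℝ (Fin d) := fun x => R (q x)
  have hf : ContDiff ℝ 1 f := R.contDiff.comp hq
  have hd : HasFDerivAt f (e : EuclideanSpace ℝ (Fin d) →L[ℝ] EuclideanSpace ℝ (Fin d)) p :=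
    R.hasFDerivAt.comp p (hq.differentiable one_ne_zero p).hasFDerivAt
  let Φ₀ := hf.contDiffAt.toOpenPartialHomeomorph f hd one_ne_zero
  -- The inverse function theorem gives a local homeomorphism; this restriction makes its inverse
  -- `C¹` on the whole target, so one chart serves every point.
  let Φ := Φ₀.restrContDiff ℝ 1 (by simp)
  have hp : p ∈ Φ₀.source := hf.contDiffAt.mem_toOpenPartialHomeomorph_source hd one_ne_zero
  have hΦp : p ∈ Φ.source := by
    refine ⟨hp, hf.contDiffAt, ?_⟩
    have hs : Φ₀.symm (Φ₀ p) = p := Φ₀.left_inv hp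
    exact Φ₀.contDiffAt_symm (Φ₀.map_source hp) (hs.symm ▸ hd) hf.contDiffAt
  refine ⟨Φ.source, Φ.open_source, hΦp, fun U hU hUo => ⟨hm, fun x hx => ?_⟩⟩
  have hsrc : (Φ.restrOpen U hUo).source = Φ.source ∩ U := Φ.restrOpen_source U hUo
  refine ⟨Φ.restrOpen U hUo, ?_, ?_, ?_, ?_⟩
  · rw [hsrc]; exact ⟨hU hx.1, hx.1⟩
  · exact hf.contDiffOn
  · refine (Φ₀.contDiffOn_restrContDiff_target ℝ (n := 1) (by simp)).mono ?_
    exact fun y hy => hy.1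
  · intro y hy
    rw [hsrc] at hy
    exact ⟨fun h => (hR (q y)).1 h.2, fun h => ⟨hy.2, (hR (q y)).2 h⟩⟩

theorem orbit_eq_iterSeq {d : ℕ}
    (g : ℕ → EuclideanSpace ℝ (Fin d) → EuclideanSpace ℝ (Fin d))
    (x : EuclideanSpace ℝ (Fin d)) (k : ℕ) : orbit g x k = iterSeq g k x := by
  induction k with
  | zero => rfl
  | succ k ih => rw [orbit, ih, iterSeq]

theorem not_summable_of_one_div_isBigO {α : ℕ → ℝ}
    (hα : (fun k : ℕ => 1 / (k : ℝ)) =O[atTop] α) : ¬ Summable α := fun h =>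
  Real.not_summable_one_div_natCast (summable_of_isBigO_nat h hα)

theorem ContDiff.taylorRemainder {d : ℕ}
    {f : EuclideanSpace ℝ (Fin d) → EuclideanSpace ℝ (Fin d)} (hf : ContDiff ℝ 1 f)
    (p : EuclideanSpace ℝ (Fin d)) : ContDiff ℝ 1 (taylorRemainder f p) := by
  unfold _root_.taylorRemainder
  fun_prop

theorem exists_pos_le_abs_of_ne_zero {d : ℕ} (l : Fin d → ℝ) :
    ∃ c : ℝ, 0 < c ∧ ∀ i, l i ≠ 0 → c ≤ |l i| := by
  have h : ∀ᶠ c in 𝓝[>] (0 : ℝ), ∀ i, l i ≠ 0 → c ≤ |l i| := by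
    rw [eventually_all]
    intro i
    by_cases hi : l i = 0
    · simp [hi]
    · filter_upwards [nhdsWithin_le_nhds (eventually_le_nhds (abs_pos.2 hi))] with c hc _
      exact hc
  obtain ⟨c, hc, hc0⟩ := (h.and self_mem_nhdsWithin).exists
  exact ⟨c, hc0, hc⟩

/-- Coordinatewise multiplication as a continuous linear map. -/
noncomputable def diagCLM {ι : Type*} [Fintype ι] (a : ι → ℝ) : (ι → ℝ) →L[ℝ] (ι → ℝ) :=
  ContinuousLinearMap.pi fun i => a i • ContinuousLinearMap.proj i

theorem diagCLM_apply {ι : Type*} [Fintype ι] (a x : ι → ℝ) (i : ι) :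
    diagCLM a x i = a i * x i := rfl

theorem norm_diagCLM_le {ι : Type*} [Fintype ι] {a : ι → ℝ} {c : ℝ} (hc : 0 ≤ c)
    (ha : ∀ i, |a i| ≤ c) (x : ι → ℝ) : ‖diagCLM a x‖ ≤ c * ‖x‖ := by
  refine (pi_norm_le_iff_of_nonneg (by positivity)).2 fun i => ?_
  rw [diagCLM_apply, norm_mul]
  exact mul_le_mul (ha i) (norm_le_pi_norm x i) (norm_nonneg _) hc

theorem le_norm_diagCLM {ι : Type*} [Fintype ι] {a : ι → ℝ} {c : ℝ} (hc : 0 < c)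
    (ha : ∀ i, c ≤ |a i|) (x : ι → ℝ) : c * ‖x‖ ≤ ‖diagCLM a x‖ := by
  rw [mul_comm, ← le_div_iff₀ hc]
  refine (pi_norm_le_iff_of_nonneg (by positivity)).2 fun i => ?_
  rw [le_div_iff₀ hc, mul_comm]
  refine le_trans ?_ (norm_le_pi_norm _ i)
  rw [diagCLM_apply, norm_mul]
  exact mul_le_mul_of_nonneg_right (ha i) (norm_nonneg _)

theorem diagCLM_surjective {ι : Type*} [Fintype ι] {a : ι → ℝ} (ha : ∀ i, a i ≠ 0) :
    Function.Surjective (diagCLM a) := fun y =>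
  ⟨fun i => y i / a i, by funext i; rw [diagCLM_apply, mul_div_cancel₀ _ (ha i)]⟩

/-! ### Reduction to a global saddle system -/

section NormalForm

variable {d : ℕ} {α : ℕ → ℝ}
  {g : ℕ → EuclideanSpace ℝ (Fin d) → EuclideanSpace ℝ (Fin d)}
  {xs : EuclideanSpace ℝ (Fin d)} {G : Matrix (Fin d) (Fin d) ℝ} {l : Fin d → ℝ}
  {T : EuclideanSpace ℝ (Fin d) ≃L[ℝ] ({i // 0 ≤ l i} → ℝ) × ({i // ¬ 0 ≤ l i} → ℝ)}

/-- In adapted coordinates, and after finitely many steps, the system agrees near its fixed point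
with a sequence of globally defined saddle steps. -/
theorem exists_saddle_normal_form
    (hαpos : ∀ k, 0 < α k) (hαlim : Tendsto α atTop (𝓝 0)) (hαs : ¬ Summable α)
    (hg : ∀ k, ContDiff ℝ 1 (g k)) (hfix : ∀ k, g k xs = xs)
    (hT : ∀ v, T (Matrix.toEuclideanCLM (𝕜 := ℝ) G v) =
        (fun i => l i.1 * (T v).1 i, fun i => l i.1 * (T v).2 i))
    (hDg : ∀ k, fderiv ℝ (g k) xs =
      ContinuousLinearMap.id ℝ (EuclideanSpace ℝ (Fin d)) -
        α k • Matrix.toEuclideanCLM (𝕜 := ℝ) G)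
    (hθ : ∀ ε : ℝ, 0 < ε → ∃ δ : ℝ, 0 < δ ∧ ∀ k : ℕ,
      ∀ u₁ ∈ Metric.ball xs δ, ∀ u₂ ∈ Metric.ball xs δ,
        ‖taylorRemainder (g k) xs u₁ - taylorRemainder (g k) xs u₂‖ ≤ α k * ε * ‖u₁ - u₂‖) :
    ∃ (K : ℕ) (ρ : ℝ) (β : ℕ → ℝ) (F : ℕ → ({i // 0 ≤ l i} → ℝ) × ({i // ¬ 0 ≤ l i} → ℝ) →
        ({i // 0 ≤ l i} → ℝ) × ({i // ¬ 0 ≤ l i} → ℝ)),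
      0 < ρ ∧ (∀ k, 0 < β k) ∧ (∀ k, β k ≤ 1) ∧ ¬ Summable β ∧
      (∀ k, IsSaddleStep (β k) (F k)) ∧
      (∀ k, ∀ u ∈ Metric.ball xs ρ, T (g (k + K) u - xs) = F k (T (u - xs))) ∧
      ((∀ i, l i ≠ 0) → ∀ k w, ‖(F k w).1‖ ≤ (1 - 4 * β k) * ‖w.1‖ + β k * ‖w‖) := by
  obtain ⟨c, hc, hcl⟩ := exists_pos_le_abs_of_ne_zero l
  obtain ⟨C, hC, hcut⟩ := exists_lipschitz_cutoff (EuclideanSpace ℝ (Fin d))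
  obtain ⟨a, ha, hTa⟩ := T.toContinuousLinearMap.bound
  obtain ⟨b, hb, hTb⟩ := T.symm.toContinuousLinearMap.bound
  set M : ℝ := a * C * b with hM
  have hMpos : 0 < M := by positivity
  -- `M` collects the cutoff constant and the bounds of `T` and its inverse, none depending on `δ`.
  -- With this `ε` the remainder in new coordinates has Lipschitz constant exactly `β k`.
  obtain ⟨δ, hδ, hθδ⟩ := hθ (c / 4 / M) (by positivity)
  obtain ⟨χ, hχ, hχ1, hχL⟩ := hcut xs δ hδ
  have hsmall : ∀ᶠ k in atTop, α k * (c / 4) ≤ 1 ∧ ∀ i, α k * l i ≤ 1 := by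
    refine Eventually.and ?_ (eventually_all.2 fun i => ?_)
    · have := hαlim.mul_const (c / 4)
      rw [zero_mul] at this
      exact this.eventually_le_const one_pos
    · have := hαlim.mul_const (l i)
      rw [zero_mul] at this
      exact this.eventually_le_const one_pos
  obtain ⟨K, hK⟩ := eventually_atTop.1 hsmall
  let β : ℕ → ℝ := fun k => α (k + K) * (c / 4)
  have hβ : ∀ k, 0 < β k := fun k => by have := hαpos (k + K); positivity
  have h4β : ∀ k, 4 * β k = α (k + K) * c := fun k => by simp only [β]; ring
  let A : ℕ → ({i // 0 ≤ l i} → ℝ) →L[ℝ] ({i // 0 ≤ l i} → ℝ) := fun k =>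
    diagCLM fun i => 1 - α (k + K) * l i.1
  let B : ℕ → ({i // ¬ 0 ≤ l i} → ℝ) →L[ℝ] ({i // ¬ 0 ≤ l i} → ℝ) := fun k =>
    diagCLM fun i => 1 - α (k + K) * l i.1
  let r : ℕ → ({i // 0 ≤ l i} → ℝ) × ({i // ¬ 0 ≤ l i} → ℝ) →
      ({i // 0 ≤ l i} → ℝ) × ({i // ¬ 0 ≤ l i} → ℝ) := fun k z =>
    T (χ (xs + T.symm z) • taylorRemainder (g (k + K)) xs (xs + T.symm z))
  have hθ0 : ∀ k, taylorRemainder (g k) xs xs = 0 := fun k => by simp [taylorRemainder]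
  have hA : ∀ k x, ‖A k x‖ ≤ ‖x‖ := fun k x => by
    have := norm_diagCLM_le (a := fun i : {i // 0 ≤ l i} => 1 - α (k + K) * l i.1) zero_le_one
      (fun i => by
        have h1 := (hK (k + K) (by omega)).2 i.1
        have h2 := mul_nonneg (hαpos (k + K)).le i.2
        exact abs_le.2 ⟨by linarith, by linarith⟩) x
    rwa [one_mul] at this
  have hBi : ∀ k (i : {i // ¬ 0 ≤ l i}), 1 + 4 * β k ≤ 1 - α (k + K) * l i.1 := fun k i => by
    have h1 := not_le.1 i.2
    have h2 := hcl i.1 h1.ne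
    rw [abs_of_neg h1] at h2
    rw [h4β]
    nlinarith [hαpos (k + K)]
  have hr0 : ∀ k, r k 0 = 0 := fun k => by simp [r, hθ0]
  have hrL : ∀ k z w, ‖r k z - r k w‖ ≤ β k * ‖z - w‖ := fun k z w => by
    have hα := hαpos (k + K)
    have h1 := hχL (taylorRemainder (g (k + K)) xs) (α (k + K) * (c / 4 / M)) (by positivity)
      (hθ0 _) (hθδ _) (xs + T.symm z) (xs + T.symm w)
    rw [add_sub_add_left_eq_sub, ← map_sub] at h1
    simp only [r]
    rw [← map_sub]
    refine (hTa _).trans ?_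
    calc _ ≤ a * (C * (α (k + K) * (c / 4 / M)) * (b * ‖z - w‖)) := by
          refine mul_le_mul_of_nonneg_left (h1.trans ?_) ha.le
          exact mul_le_mul_of_nonneg_left (hTb _) (by positivity)
      _ = M * (α (k + K) * (c / 4 / M)) * ‖z - w‖ := by rw [hM]; ring
      _ = β k * ‖z - w‖ := by simp only [β]; field_simp
  refine ⟨K, δ / 2, β, fun k z => (A k z.1, B k z.2) + r k z, half_pos hδ, hβ,
    fun k => (hK (k + K) (by omega)).1, ?_, fun k => ?_, fun k u hu => ?_, fun hl k w => ?_⟩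
  · intro h
    refine hαs ((summable_nat_add_iff K).1 ?_)
    exact (summable_mul_right_iff (by positivity)).1 h
  · refine isSaddleStep_of_lipschitz (hβ k) (A k) (B k) (hA k) (fun y => ?_) ?_ ?_ (hr0 k) (hrL k)
    · exact le_norm_diagCLM (by linarith [hβ k]) (fun i => (hBi k i).trans (le_abs_self _)) y
    · exact diagCLM_surjective fun i => by linarith [hBi k i, hβ k]
    · have h1 := (hg (k + K)).taylorRemainder xs
      have h2 : ContDiff ℝ 1 fun z => xs + T.symm z := contDiff_const.add T.symm.contDiff
      exact T.contDiff.comp ((hχ.comp h2).smul (h1.comp h2))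
  · have h1 : g (k + K) u - xs = (u - xs) - α (k + K) • Matrix.toEuclideanCLM (𝕜 := ℝ) G (u - xs) +
        taylorRemainder (g (k + K)) xs u := by
      rw [taylorRemainder, hfix, hDg]
      simp only [sub_apply, smul_apply,
        ContinuousLinearMap.id_apply]
      abel
    have h2 : r k (T (u - xs)) = T (taylorRemainder (g (k + K)) xs u) := by
      simp only [r]
      rw [T.symm_apply_apply, add_sub_cancel, hχ1 u hu, one_smul]
    rw [h1, map_add, map_sub, map_smul, hT]
    change _ = (A k (T (u - xs)).1, B k (T (u - xs)).2) + r k (T (u - xs))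
    rw [h2]
    congr 1
    ext i
    · change _ - α (k + K) * (l i.1 * _) = (1 - α (k + K) * l i.1) * (T (u - xs)).1 i
      ring
    · change _ - α (k + K) * (l i.1 * _) = (1 - α (k + K) * l i.1) * (T (u - xs)).2 i
      ring
  · have h1 : ‖A k w.1‖ ≤ (1 - 4 * β k) * ‖w.1‖ := by
      -- The factor `1 - 4β k` is seen to be nonnegative only through some index, so an empty stable
      -- factor is treated apart.
      rcases isEmpty_or_nonempty {i // 0 ≤ l i} with he | ⟨⟨i₀⟩⟩
      · rw [Subsingleton.elim w.1 0]; simp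
      · have hi : ∀ i : {i // 0 ≤ l i}, |1 - α (k + K) * l i.1| ≤ 1 - 4 * β k := fun i => by
          have h2 := hcl i.1 (hl i.1)
          rw [abs_of_nonneg i.2] at h2
          rw [h4β, abs_of_nonneg (by linarith [(hK (k + K) (by omega)).2 i.1])]
          nlinarith [hαpos (k + K)]
        exact norm_diagCLM_le ((abs_nonneg _).trans (hi i₀)) hi w.1
    have h2 : ‖(r k w).1‖ ≤ β k * ‖w‖ := by
      have := hrL k w 0
      rw [hr0, sub_zero, sub_zero] at this
      exact (norm_fst_le _).trans this
    exact (norm_add_le _ _).trans (add_le_add h1 h2)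

/-- Chain rule at the common fixed point: the derivatives are simultaneously diagonal, so the
products can be read off coordinatewise. -/
theorem fderiv_iterSeq_fixedPoint (hg : ∀ k, ContDiff ℝ 1 (g k)) (hfix : ∀ k, g k xs = xs)
    (hT : ∀ v, T (Matrix.toEuclideanCLM (𝕜 := ℝ) G v) =
        (fun i => l i.1 * (T v).1 i, fun i => l i.1 * (T v).2 i))
    (hDg : ∀ k, fderiv ℝ (g k) xs =
      ContinuousLinearMap.id ℝ (EuclideanSpace ℝ (Fin d)) -
        α k • Matrix.toEuclideanCLM (𝕜 := ℝ) G) (k : ℕ) :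
    iterSeq g k xs = xs ∧ ∀ v, T (fderiv ℝ (iterSeq g k) xs v) =
      (fun i => (∏ j ∈ Finset.range k, (1 - α j * l i.1)) * (T v).1 i,
        fun i => (∏ j ∈ Finset.range k, (1 - α j * l i.1)) * (T v).2 i) := by
  induction k with
  | zero =>
    refine ⟨rfl, fun v => ?_⟩
    have : iterSeq g 0 = id := rfl
    simp [this]
  | succ k ih =>
    refine ⟨by rw [iterSeq, ih.1, hfix], fun v => ?_⟩
    have h1 : fderiv ℝ (iterSeq g (k + 1)) xs =
        (fderiv ℝ (g k) (iterSeq g k xs)).comp (fderiv ℝ (iterSeq g k) xs) :=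
      fderiv_comp (g := g k) (f := iterSeq g k) xs ((hg k).differentiable one_ne_zero _)
        ((ContDiff.iterSeq hg k).differentiable one_ne_zero _)
    rw [h1, ih.1, hDg]
    simp only [ContinuousLinearMap.comp_apply, sub_apply,
      smul_apply, ContinuousLinearMap.id_apply, map_sub, map_smul, hT, ih.2,
      Finset.prod_range_succ]
    ext i
    · change _ - α k * (l i.1 * _) = _
      ring
    · change _ - α k * (l i.1 * _) = _
      ring

end NormalForm

/-! ### Assembly of the neighborhood and the submanifold -/

theorem corollary4p2 {d : ℕ} (α : ℕ → ℝ)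
    (hαpos : ∀ k, 0 < α k)
    (hαlim : Tendsto α atTop (𝓝 0))
    (hαΩ : (fun k : ℕ => 1 / (k : ℝ)) =O[atTop] α)
    (g : ℕ → EuclideanSpace ℝ (Fin d) → EuclideanSpace ℝ (Fin d))
    (hg : ∀ k, ContDiff ℝ 1 (g k))
    (xs : EuclideanSpace ℝ (Fin d))
    (hfix : ∀ k, g k xs = xs)
    (G : Matrix (Fin d) (Fin d) ℝ)
    (hGdiag : IsRealDiagonalizable G)
    (hGneg : ∃ μ : ℝ, μ < 0 ∧ Module.End.HasEigenvalue (Matrix.toLin' G) μ)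
    (hDg : ∀ k, fderiv ℝ (g k) xs =
      ContinuousLinearMap.id ℝ (EuclideanSpace ℝ (Fin d)) -
        α k • Matrix.toEuclideanCLM (𝕜 := ℝ) G)
    (hθ : ∀ ε : ℝ, 0 < ε → ∃ δ : ℝ, 0 < δ ∧ ∀ k : ℕ,
      ∀ u₁ ∈ Metric.ball xs δ, ∀ u₂ ∈ Metric.ball xs δ,
        ‖taylorRemainder (g k) xs u₁ - taylorRemainder (g k) xs u₂‖ ≤ α k * ε * ‖u₁ - u₂‖) :
    ∃ (U W : Set (EuclideanSpace ℝ (Fin d))) (m : ℕ),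
      IsOpen U ∧ xs ∈ U ∧ W ⊆ U ∧ IsC1Submanifold m W ∧ m + 1 ≤ d ∧
      {x₀ | ∀ k, orbit g x₀ k ∈ U} ⊆ W ∧
      (IsUnit G.det → ∀ x₀ ∈ W, Tendsto (orbit g x₀) atTop (𝓝 xs)) := by
  obtain ⟨l, T, hT, hspec, hdet⟩ := hGdiag.exists_splitting
  obtain ⟨K, ρ, β, F, hρ, hβ, hβ1, hβs, hF, hconj, hcontr⟩ := exists_saddle_normal_form hαpos
    hαlim (not_summable_of_one_div_isBigO hαΩ) hg hfix hT hDg hθ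
  obtain ⟨h, hh, h0, hslow, hcone⟩ := exists_contDiff_slow_graph hβ hβ1 hβs hF
  obtain ⟨R, hR⟩ := exists_coordinate_equiv fun i => 0 ≤ l i
  obtain ⟨hKfix, hKD⟩ := fderiv_iterSeq_fixedPoint hg hfix hT hDg K
  have hcard : Fintype.card {i // 0 ≤ l i} + 1 ≤ d := by
    obtain ⟨μ, hμ, hev⟩ := hGneg
    obtain ⟨i, hi⟩ := hspec μ hev
    have := Fintype.card_subtype_lt (p := fun i => 0 ≤ l i) (x := i) (by rw [hi]; exact hμ.not_ge)
    rw [Fintype.card_fin] at this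
    omega
  let Z : EuclideanSpace ℝ (Fin d) → ({i // 0 ≤ l i} → ℝ) × ({i // ¬ 0 ≤ l i} → ℝ) :=
    fun x => T (iterSeq g K x - xs)
  have hZ : ContDiff ℝ 1 Z := T.contDiff.comp ((ContDiff.iterSeq hg K).sub contDiff_const)
  have hZ0 : Z xs = 0 := by simp [Z, hKfix]
  have hZD : HasFDerivAt Z (T.toContinuousLinearMap.comp (fderiv ℝ (iterSeq g K) xs)) xs :=
    T.toContinuousLinearMap.hasFDerivAt.comp xs
      (((ContDiff.iterSeq hg K).differentiable one_ne_zero xs).hasFDerivAt.sub_const xs)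
  -- The first component uses the initial point rather than `Z x`: a factor `1 - α j * l i` may
  -- vanish for `l i > 0` and early `j`, whereas for `l i < 0` it exceeds `1`. Hence the derivative
  -- of `q` is injective regardless.
  let q : EuclideanSpace ℝ (Fin d) → ({i // 0 ≤ l i} → ℝ) × ({i // ¬ 0 ≤ l i} → ℝ) :=
    fun x => ((T (x - xs)).1, (Z x).2 - h (Z x).1)
  have hq : ContDiff ℝ 1 q := by
    have h1 : ContDiff ℝ 1 fun x => T (x - xs) := T.contDiff.comp (contDiff_id.sub contDiff_const)
    exact h1.fst.prodMk (hZ.snd.sub (hh.comp hZ.fst))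
  have hinj : Function.Injective (fderiv ℝ q xs) := by
    rw [injective_iff_map_eq_zero]
    intro v hv
    have hd1 : HasFDerivAt (fun x => T (x - xs)) T.toContinuousLinearMap xs :=
      T.toContinuousLinearMap.hasFDerivAt.comp xs ((hasFDerivAt_id xs).sub_const xs)
    have hd2 := (hh.differentiable one_ne_zero (Z xs).1).hasFDerivAt.comp xs hZD.fst
    have hd := hd1.fst.prodMk (hZD.snd.sub hd2)
    have hv' : fderiv ℝ q xs v = _ := congrArg (fun L => L v) hd.fderiv
    rw [hv] at hv'
    have hT1 : (T v).1 = 0 := (congrArg Prod.fst hv').symm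
    have hZ1 : (T (fderiv ℝ (iterSeq g K) xs v)).1 = 0 := by
      rw [hKD, hT1]
      funext i
      simp
    have hT2 : (T (fderiv ℝ (iterSeq g K) xs v)).2 -
        fderiv ℝ h (Z xs).1 (T (fderiv ℝ (iterSeq g K) xs v)).1 = 0 :=
      (congrArg Prod.snd hv').symm
    rw [hZ1, map_zero, sub_zero, hKD] at hT2
    have hT3 : (T v).2 = 0 := by
      funext i
      have h1 := congrFun hT2 i
      refine (mul_eq_zero.1 h1).resolve_left (Finset.prod_ne_zero_iff.2 fun j _ => ?_)
      nlinarith [hαpos j, not_le.1 i.2]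
    have : T v = 0 := Prod.ext hT1 hT3
    simpa using this
  obtain ⟨O, hO, hxO, hsub⟩ := exists_isC1Submanifold (by omega) R hR hq hinj
  obtain ⟨b, hb, hTb⟩ := T.symm.toContinuousLinearMap.bound
  obtain ⟨a, ha, hTa⟩ := T.toContinuousLinearMap.bound
  -- The radius `ρ / b` for `Z x` ensures that orbits on the graph, whose norm does not increase in
  -- the contracting case, stay in the ball of radius `ρ` where the conjugacy holds.
  let U : Set (EuclideanSpace ℝ (Fin d)) :=
    O ∩ (Metric.ball xs ρ ∩ Z ⁻¹' Metric.ball 0 (ρ / b))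
  have hU : IsOpen U := hO.inter (Metric.isOpen_ball.inter
    (Metric.isOpen_ball.preimage hZ.continuous))
  have hshift : ∀ x k, iterSeq g (k + K) x ∈ Metric.ball xs ρ →
      T (iterSeq g (k + K) x - xs) = iterSeq F k (Z x) →
      T (iterSeq g (k + 1 + K) x - xs) = iterSeq F (k + 1) (Z x) := by
    intro x k hk hk'
    rw [Nat.add_right_comm, iterSeq, hconj k _ hk, hk', iterSeq]
  refine ⟨U, {x ∈ U | (q x).2 = 0}, Fintype.card {i // 0 ≤ l i}, hU,
    ⟨hxO, Metric.mem_ball_self hρ, ?_⟩, fun x hx => hx.1, hsub U Set.inter_subset_left hU, hcard,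
    fun x hx => ⟨hx 0, ?_⟩, fun hGdet x hx => ?_⟩
  · rw [Set.mem_preimage, hZ0]
    exact Metric.mem_ball_self (by positivity)
  · have hball : ∀ k, iterSeq g k x ∈ Metric.ball xs ρ := fun k => by
      rw [← orbit_eq_iterSeq]; exact (hx k).2.1
    have horb : ∀ k, T (iterSeq g (k + K) x - xs) = iterSeq F k (Z x) := by
      intro k
      induction k with
      | zero => rw [zero_add]; rfl
      | succ k ih => exact hshift x k (hball _) ih
    -- A bounded orbit is slow because `growth β k ≥ 1`.
    refine sub_eq_zero.2 (hslow (Z x) (a * ρ) fun k => ?_)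
    rw [← horb k]
    refine (hTa _).trans ((mul_le_mul_of_nonneg_left (mem_ball_iff_norm.1 (hball _)).le
      ha.le).trans (le_mul_of_one_le_right (by positivity)
        (one_le_growth (fun k => (hβ k).le) k)))
  · have hz : Z x = ((Z x).1, h (Z x).1) := Prod.ext rfl (sub_eq_zero.1 hx.2)
    have hcone' : ∀ k, ‖(iterSeq F k (Z x)).2‖ ≤ ‖(iterSeq F k (Z x)).1‖ := fun k => by
      rw [hz]; exact hcone _ k
    obtain ⟨hle, hlim⟩ := tendsto_iterSeq_of_cone hβ hβs hcone' (hcontr (hdet hGdet))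
    have hZx : ‖Z x‖ < ρ / b := mem_ball_zero_iff.1 hx.1.2.2
    have horb : ∀ k, T (iterSeq g (k + K) x - xs) = iterSeq F k (Z x) := by
      intro k
      induction k with
      | zero => rw [zero_add]; rfl
      | succ k ih =>
        refine hshift x k ?_ ih
        rw [mem_ball_iff_norm, ← T.symm_apply_apply (iterSeq g (k + K) x - xs), ih]
        calc _ ≤ b * ‖iterSeq F k (Z x)‖ := hTb _
          _ ≤ b * ‖Z x‖ := mul_le_mul_of_nonneg_left (hle k) hb.le
          _ < b * (ρ / b) := mul_lt_mul_of_pos_left hZx hb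
          _ = ρ := mul_div_cancel₀ _ hb.ne'
    rw [← tendsto_add_atTop_iff_nat K]
    have h1 := ((T.symm.continuous.tendsto 0).comp hlim).const_add xs
    rw [map_zero, add_zero] at h1
    refine h1.congr fun k => ?_
    rw [Function.comp_apply, ← horb k, T.symm_apply_apply, orbit_eq_iterSeq, add_sub_cancel]
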